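/- Let ${\mathbb K}$ be a field and let $E=(E^0,E^1,r,s)$ be a directed graph (an arbitrary set $E^0$ of vertices, an arbitrary set $E^1$ of edges, range and source maps $r,s:E^1\to E^0$). A path is a finite sequence of edges $e_1\cdots e_n$ with $r(e_i)=s(e_{i+1})$, or a vertex (a path of length $0$). A cycle is a path $e_1\cdots e_n$ with $n\ge 1$, $r(e_n)=s(e_1)$ and $s(e_i)\ne s(e_j)$ for $i\neq j$; $E$ is acyclic if it has no cycle. $E$ satisfies Condition (MT3) if for all vertices $v,w$ there is a vertex $x$ such that there are a path from $v$ to $x$ and a path from $w$ to $x$. The Leavitt path algebra $L_{\mathbb K}(E)$ is the associative (not necessarily unital) ${\mathbb K}$-algebra generated by the vertices $v\in E^0$, the edges $e\in E^1$ and symbols $e^*$ ($e\in E^1$), subject to the relations: $vw=\delta_{v,w}v$ for $v,w\in E^0$; $s(e)e=er(e)=e$ and $r(e)e^*=e^*s(e)=e^*$ for $e\in E^1$; $e^*f=\delta_{e,f}\,r(e)$ for $e,f\in E^1$; and $v=\sum_{e\in s^{-1}(v)}ee^*$ for every vertex $v$ for which $s^{-1}(v)$ is finite and nonempty. An algebra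 is prime if it is nonzero and the product of any two nonzero two-sided ideals is nonzero. The centroid $\mathcal C(A)$ of a ${\mathbb K}$-algebra $A$ is the ${\mathbb K}$-algebra, under composition, of all ${\mathbb K}$-linear maps $\tau:A\to A$ with $\tau(xy)=\tau(x)y=x\tau(y)$ for all $x,y\in A$. Proposition. (1) If $L_{\mathbb K}(E)$ is prime and $E$ is acyclic, then $\mathcal C(L_{\mathbb K}(E))\cong{\mathbb K}$ as ${\mathbb K}$-algebras. (2) If $E$ is acyclic and satisfies Condition (MT3), then for every vertex $u\in E^0$ the center of the corner $u\,L_{\mathbb K}(E)\,u$ is ${\mathbb K}u=\{ku : k\in{\mathbb K}\}$. -/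

import Mathlib

noncomputable section

namespace LPA

open Quiver

universe u v w

/-! ### Directed graphs

A directed graph is a quiver: the vertices are the elements of `V`, the edges are the elements
`e` of `Quiver.Total V`, with source `e.left` and range `e.right`. -/

section Graph

variable {V : Type u} [Quiver.{v} V]

/-- A cycle: a closed path of positive length `e₁ ⋯ eₙ` whose edges have pairwise distinct sources.
The list `p.vertices` is `s(e₁), …, s(eₙ), r(eₙ)`. -/
def IsCycle {a : V} (p : Path a a) : Prop :=
  0 < p.length ∧ p.vertices.dropLast.Nodup

variable (V) in
/-- A graph without cycles. -/
def IsAcyclic : Prop :=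
  ∀ (a : V) (p : Path a a), ¬ IsCycle p

variable (V) in
/-- Condition (MT3), downward directedness: any two vertices connect to a common vertex. -/
def ConditionMT3 : Prop :=
  ∀ a b : V, ∃ c : V, Nonempty (Path a c) ∧ Nonempty (Path b c)

end Graph

/-! ### Leavitt path algebras -/

section Leavitt

variable (K : Type w) [CommRing K] (V : Type u) [Quiver.{v} V]

/-- The generators: the vertices `v`, the real edges `e` and the ghost edges `e*`. -/
inductive Gen : Type max u v
  | vertex (a : V) : Gen
  | edge (e : Total V) : Gen
  | ghost (e : Total V) : Gen

/-- The free associative (non-unital) `K`-algebra on the vertices, real edges and ghost edges. -/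
abbrev FreeAlg : Type max u v w := MonoidAlgebra K (FreeSemigroup (Gen V))

variable {V} in
/-- A generator, as an element of the free algebra. -/
def FreeAlg.of (x : Gen V) : FreeAlg K V := MonoidAlgebra.ofMagma K _ (FreeSemigroup.of x)

/-- The defining relations of the Leavitt path algebra. -/
inductive Rel : FreeAlg K V → FreeAlg K V → Prop
  | v_same (a : V) : Rel (.of K (.vertex a) * .of K (.vertex a)) (.of K (.vertex a))
  | v_ne (a b : V) (h : a ≠ b) : Rel (.of K (.vertex a) * .of K (.vertex b)) 0
  | e1_left (e : Total V) : Rel (.of K (.vertex e.left) * .of K (.edge e)) (.of K (.edge e))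
  | e1_right (e : Total V) : Rel (.of K (.edge e) * .of K (.vertex e.right)) (.of K (.edge e))
  | e2_left (e : Total V) : Rel (.of K (.vertex e.right) * .of K (.ghost e)) (.of K (.ghost e))
  | e2_right (e : Total V) : Rel (.of K (.ghost e) * .of K (.vertex e.left)) (.of K (.ghost e))
  | ck1_same (e : Total V) : Rel (.of K (.ghost e) * .of K (.edge e)) (.of K (.vertex e.right))
  | ck1_ne (e f : Total V) (h : e ≠ f) : Rel (.of K (.ghost e) * .of K (.edge f)) 0
  /-- (CK2) is imposed at the regular vertices: those for which the set `S` of the edges with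
  source `a` is finite and nonempty. -/
  | ck2 (a : V) (S : Finset (Total V)) (hS : ∀ e, e ∈ S ↔ e.left = a) (hne : S.Nonempty) :
      Rel (.of K (.vertex a)) (∑ e ∈ S, .of K (.edge e) * .of K (.ghost e))

/-- The congruence generated by the `K`-multiples of the defining relations; the class of `0` is
the algebra ideal generated by the defining relations. -/
def con : RingCon (FreeAlg K V) :=
  ringConGen fun x y => ∃ (k : K) (a b : FreeAlg K V), Rel K V a b ∧ x = k • a ∧ y = k • b

variable {K V} in
theorem con_smul (k : K) (x y : FreeAlg K V) (h : con K V x y) : con K V (k • x) (k • y) := by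
  change RingConGen.Rel _ _ _ at h
  change RingConGen.Rel _ _ _
  induction h with
  | of x y h =>
    obtain ⟨l, a, b, hab, rfl, rfl⟩ := h
    exact .of _ _ ⟨k * l, a, b, hab, (mul_smul _ _ _).symm, (mul_smul _ _ _).symm⟩
  | refl x => exact .refl _
  | symm _ ih => exact .symm ih
  | trans _ _ ih₁ ih₂ => exact .trans ih₁ ih₂
  | add _ _ ih₁ ih₂ => rw [smul_add, smul_add]; exact .add ih₁ ih₂
  | mul _ h₂ ih₁ _ => rw [← smul_mul_assoc, ← smul_mul_assoc]; exact .mul ih₁ h₂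

/-- The Leavitt path algebra of the graph `V` with coefficients in `K`. -/
def LeavittPathAlgebra : Type max u v w := (con K V).Quotient

namespace LeavittPathAlgebra

instance : NonUnitalRing (LeavittPathAlgebra K V) :=
  inferInstanceAs (NonUnitalRing (con K V).Quotient)

/-- The class of an element of the free algebra. -/
def mk (x : FreeAlg K V) : LeavittPathAlgebra K V := (x : (con K V).Quotient)

theorem mk_surjective : Function.Surjective (mk K V) := Quotient.mk''_surjective

/-- Scalar multiplication, `k • mk x = mk (k • x)`. -/
instance : SMul K (LeavittPathAlgebra K V) :=
  ⟨(con K V).smulAux con_smul⟩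

instance : Module K (LeavittPathAlgebra K V) :=
  Function.Surjective.module K
    { toFun := mk K V, map_zero' := rfl, map_add' := fun _ _ => rfl }
    (mk_surjective K V) (fun _ _ => rfl)

instance : IsScalarTower K (LeavittPathAlgebra K V) (LeavittPathAlgebra K V) where
  smul_assoc k x y := by
    obtain ⟨x, rfl⟩ := mk_surjective K V x
    obtain ⟨y, rfl⟩ := mk_surjective K V y
    exact congrArg (mk K V) (smul_mul_assoc k x y)

instance : SMulCommClass K (LeavittPathAlgebra K V) (LeavittPathAlgebra K V) where
  smul_comm k x y := by
    obtain ⟨x, rfl⟩ := mk_surjective K V x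
    obtain ⟨y, rfl⟩ := mk_surjective K V y
    exact congrArg (mk K V) (mul_smul_comm k x y).symm

variable {V} in
/-- The vertex `a`, as an element of the Leavitt path algebra. -/
def vertex (a : V) : LeavittPathAlgebra K V := mk K V (.of K (.vertex a))

end LeavittPathAlgebra

end Leavitt

/-! ### Prime algebras, centroids -/

section Ring

/-- A (possibly non-unital) ring is prime if it is nonzero and the product of two nonzero
two-sided ideals is nonzero. -/
def IsPrimeRing (A : Type u) [NonUnitalRing A] : Prop :=
  Nontrivial A ∧
    ∀ I J : TwoSidedIdeal A, (∀ x ∈ I, ∀ y ∈ J, x * y = 0) → I = ⊥ ∨ J = ⊥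

variable (K : Type w) [CommRing K] (A : Type u) [NonUnitalRing A] [Module K A]
  [IsScalarTower K A A] [SMulCommClass K A A]

/-- The centroid of a `K`-algebra `A`: the `K`-algebra under composition of all `K`-linear maps
`τ : A → A` with `τ(xy) = τ(x)y = xτ(y)`. -/
def centroid : Subalgebra K (Module.End K A) where
  carrier := {τ | ∀ x y : A, τ (x * y) = τ x * y ∧ τ (x * y) = x * τ y}
  mul_mem' := by
    intro σ τ hσ hτ x y
    simp only [Module.End.mul_apply]
    exact ⟨by rw [(hτ x y).1, (hσ _ _).1], by rw [(hτ x y).2, (hσ _ _).2]⟩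
  add_mem' := by
    intro σ τ hσ hτ x y
    simp only [LinearMap.add_apply]
    exact ⟨by rw [(hτ x y).1, (hσ x y).1, add_mul], by rw [(hτ x y).2, (hσ x y).2, mul_add]⟩
  algebraMap_mem' := by
    intro k x y
    simp only [Module.algebraMap_end_apply]
    exact ⟨(smul_mul_assoc k x y).symm, (mul_smul_comm k x y).symm⟩

end Ring

end LPA

end

noncomputable section

namespace LPA

open Quiver

universe u v w

/-! ### Closed paths in acyclic graphs -/

section Graph

variable {V : Type u} [Quiver.{v} V]

/-! Everything rests on a reduction theorem (`exists_ghostPath_mul_mul_ofPath`): in an acyclic graph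
every `x ≠ 0` satisfies `p* x q = k c` for paths `p`, `q` ending at a vertex `c` and some `k ≠ 0`.
Multiplying by edges on the right removes ghost edges. In a combination of real paths with a common
range, `p*` then isolates one path `p`, because distinct parallel paths are never initial segments
of each other. A representation shows that vertices are nonzero.

Let `z` be central in the corner at `u`, with `p* z q = k c`. Commuting `z` with `q p*` forces `p =
q`; commuting it with `p p*` gives `z p = k p`. So `w = z - k u` kills `p`, and centrality gives `w
l p = 0` for all `l`; primeness yields `w = 0` (`exists_eq_smul_vertex`). Under (MT3), the reduction
theorem itself supplies primeness.

A centroid element `τ` sends `u` to a central element of its corner, so `τ u = k u`. Then `(τ y - k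
y) l u = 0` for all `y`, `l`, and primeness gives `τ = k`. -/

theorem exists_closed_path_of_not_nodup {a b : V} (p : Path a b) (hp : ¬ p.vertices.Nodup) :
    ∃ (c : V) (q : Path c c), 0 < q.length ∧ q.length ≤ p.length := by
  induction p with
  | nil => simp at hp
  | @cons b c p e ih =>
    by_cases hn : p.vertices.Nodup
    · have hc : c ∈ p.vertices := by
        by_contra hc
        apply hp
        rw [Path.vertices_cons, List.concat_eq_append, List.nodup_append]
        exact ⟨hn, List.nodup_singleton c, fun x hx y hy => by
          rw [List.mem_singleton] at hy; rintro rfl; exact hc (hy ▸ hx)⟩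
      -- The last edge returns to a visited vertex, so the segment since that visit closes up.
      obtain ⟨p₁, p₂, h⟩ := p.exists_eq_comp_of_mem_vertices hc
      refine ⟨c, p₂.cons e, by simp, ?_⟩
      rw [h]
      simp
    · obtain ⟨d, q, h₁, h₂⟩ := ih hn
      exact ⟨d, q, h₁, h₂.trans (by simp)⟩

/-- In an acyclic graph the only closed paths are the vertices. -/
theorem IsAcyclic.eq_nil (hV : IsAcyclic V) {a : V} (p : Path a a) : p = Path.nil := by
  suffices H : ∀ (n : ℕ) (a : V) (p : Path a a), p.length = n → n = 0 from
    Path.eq_nil_of_length_zero p (H _ a p rfl)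
  intro n
  induction n using Nat.strong_induction_on with
  | _ n ih =>
    intro a p hp
    by_contra hn
    -- A repetition among the sources occurs before the last edge, so it yields a strictly shorter
    -- nontrivial closed path.
    have hnd : ¬ p.vertices.dropLast.Nodup := fun h => hV a p ⟨by omega, h⟩
    cases p with
    | nil => simp at hnd
    | cons p e =>
      rw [Path.vertices_cons, List.concat_eq_append, List.dropLast_concat] at hnd
      obtain ⟨c, q, h₁, h₂⟩ := exists_closed_path_of_not_nodup p hnd
      rw [Path.length_cons] at hp
      have := ih q.length (by omega) c q rfl
      omega

/-- `Path` grows at its target; cancelling `e*` against a path requires its first edge. -/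
theorem eq_nil_or_eq_comp {a b : V} (p : Path a b) :
    (∃ h : a = b, p = h ▸ Path.nil) ∨ ∃ (c : V) (e : a ⟶ c) (q : Path c b), p = e.toPath.comp q := by
  induction p with
  | nil => exact .inl ⟨rfl, rfl⟩
  | cons p e ih =>
    rcases ih with ⟨h, hp⟩ | ⟨c, f, q, rfl⟩
    · subst h
      subst hp
      exact .inr ⟨_, e, .nil, rfl⟩
    · exact .inr ⟨c, f, q.cons e, rfl⟩

end Graph

/-! ### The generators and their relations -/

namespace LeavittPathAlgebra

variable {K : Type w} [CommRing K] {V : Type u} [Quiver.{v} V]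

variable (K) in
/-- The edge `e`, as an element of the Leavitt path algebra. -/
def edge (e : Total V) : LeavittPathAlgebra K V := mk K V (.of K (.edge e))

variable (K) in
/-- The ghost edge `e*`, as an element of the Leavitt path algebra. -/
def ghost (e : Total V) : LeavittPathAlgebra K V := mk K V (.of K (.ghost e))

theorem mk_add (x y : FreeAlg K V) : mk K V (x + y) = mk K V x + mk K V y := rfl
theorem mk_smul (k : K) (x : FreeAlg K V) : mk K V (k • x) = k • mk K V x := rfl

theorem mk_sum {ι : Type*} (s : Finset ι) (f : ι → FreeAlg K V) :
    mk K V (∑ i ∈ s, f i) = ∑ i ∈ s, mk K V (f i) :=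
  map_sum (AddMonoidHom.mk' (mk K V) mk_add) f s

theorem mk_eq_of_rel {x y : FreeAlg K V} (h : Rel K V x y) : mk K V x = mk K V y :=
  (RingCon.eq _).2 (RingConGen.Rel.of _ _ ⟨1, x, y, h, (one_smul _ _).symm, (one_smul _ _).symm⟩)

theorem vertex_mul_self (a : V) : vertex K a * vertex K a = vertex K a :=
  mk_eq_of_rel (.v_same a)

theorem vertex_mul_of_ne {a b : V} (h : a ≠ b) : vertex K a * vertex K b = 0 :=
  mk_eq_of_rel (.v_ne a b h)

theorem left_mul_edge (e : Total V) : vertex K e.left * edge K e = edge K e :=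
  mk_eq_of_rel (.e1_left e)

theorem edge_mul_right (e : Total V) : edge K e * vertex K e.right = edge K e :=
  mk_eq_of_rel (.e1_right e)

theorem right_mul_ghost (e : Total V) : vertex K e.right * ghost K e = ghost K e :=
  mk_eq_of_rel (.e2_left e)

theorem ghost_mul_left (e : Total V) : ghost K e * vertex K e.left = ghost K e :=
  mk_eq_of_rel (.e2_right e)

theorem ghost_mul_edge_self (e : Total V) : ghost K e * edge K e = vertex K e.right :=
  mk_eq_of_rel (.ck1_same e)

theorem ghost_mul_edge_of_ne {e f : Total V} (h : e ≠ f) : ghost K e * edge K f = 0 :=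
  mk_eq_of_rel (.ck1_ne e f h)

theorem vertex_eq_sum (a : V) (S : Finset (Total V)) (hS : ∀ e, e ∈ S ↔ e.left = a)
    (hne : S.Nonempty) : vertex K a = ∑ e ∈ S, edge K e * ghost K e :=
  (mk_eq_of_rel (.ck2 a S hS hne)).trans (mk_sum _ _)

theorem vertex_mul_edge_of_ne {a : V} {e : Total V} (h : a ≠ e.left) :
    vertex K a * edge K e = 0 := by
  rw [← left_mul_edge, ← mul_assoc, vertex_mul_of_ne h, zero_mul]

theorem vertex_mul_ghost_of_ne {a : V} {e : Total V} (h : a ≠ e.right) :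
    vertex K a * ghost K e = 0 := by
  rw [← right_mul_ghost, ← mul_assoc, vertex_mul_of_ne h, zero_mul]

/-! ### Vertices are nonzero -/

variable (V) in
/-- The edges can be made to act injectively on an infinite set `I` in such a way that, for every
vertex `a` which is not a sink, `I` is the disjoint union of the images of the edges with source
`a`. -/
theorem exists_branching : ∃ σ : Total V → Total V ⊕ ℕ → Total V ⊕ ℕ,
    (∀ (e f : Total V) i j, e.left = f.left → σ e i = σ f j → e = f ∧ i = j) ∧
    ∀ (e : Total V) (i : Total V ⊕ ℕ), ∃ (f : Total V) (j : Total V ⊕ ℕ),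
      f.left = e.left ∧ σ f j = i := by
  -- The set `Total V ⊕ ℕ` is infinite and at least as large as each set of edges leaving a vertex,
  -- so multiplying by a nonempty such set keeps its cardinality.
  have key : ∀ a : V, Nonempty {e : Quiver.Total V // e.left = a} →
      Nonempty ({e : Quiver.Total V // e.left = a} × (Total V ⊕ ℕ) ≃ (Total V ⊕ ℕ)) := by
    intro a ha
    rw [← Cardinal.eq, Cardinal.mk_prod, Cardinal.lift_id, Cardinal.lift_id]
    refine Cardinal.mul_eq_right (Cardinal.aleph0_le_mk _) ?_ (Cardinal.mk_ne_zero _)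
    exact Cardinal.mk_le_of_injective (f := fun e => Sum.inl e.1)
      fun e f h => Subtype.ext (Sum.inl_injective h)
  have φ := fun a h => (key a h).some
  refine ⟨fun e i => φ e.left ⟨⟨e, rfl⟩⟩ (⟨e, rfl⟩, i), ?_, ?_⟩
  · intro e f i j h hσ
    -- The bijection depends on the source, so both edges are first moved to one variable vertex.
    have aux : ∀ (a : V) (ha : e.left = a) (hb : f.left = a),
        φ a ⟨⟨e, ha⟩⟩ (⟨e, ha⟩, i) = φ a ⟨⟨f, hb⟩⟩ (⟨f, hb⟩, j) → e = f ∧ i = j := by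
      intro a ha hb h
      have := (φ a ⟨⟨e, ha⟩⟩).injective h
      simpa using this
    refine aux f.left h rfl (Eq.trans ?_ hσ)
    clear aux hσ
    generalize f.left = b at h
    subst h
    rfl
  · intro e i
    obtain ⟨⟨⟨f, hf⟩, j⟩, h⟩ := (φ e.left ⟨⟨e, rfl⟩⟩).surjective i
    have aux : ∀ (a : V) (ha : f.left = a),
        φ f.left ⟨⟨f, rfl⟩⟩ (⟨f, rfl⟩, j) = φ a ⟨⟨f, ha⟩⟩ (⟨f, ha⟩, j) := by
      rintro _ rfl
      rfl
    exact ⟨f, j, hf, (aux _ hf).trans h⟩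

section Representation

variable (K) in
open Classical in
/-- The action of the generators given by a branching system on `V × I`: the edge `e` maps
functions on `{e.right} × I` to functions on `{e.left} × σ e I`. -/
def genAction {I : Type*} (σ : Total V → I → I) : Gen V → Module.End K (V × I → K)
  | .vertex a =>
    { toFun := fun f x => if x.1 = a then f x else 0
      map_add' := fun f g => by ext x; by_cases h : x.1 = a <;> simp [h]
      map_smul' := fun k f => by ext x; by_cases h : x.1 = a <;> simp [h] }
  | .edge e =>
    { toFun := fun f x =>
        if h : x.1 = e.left ∧ ∃ j, σ e j = x.2 then f (e.right, h.2.choose) else 0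
      map_add' := fun f g => by
        ext x; by_cases h : x.1 = e.left ∧ ∃ j, σ e j = x.2 <;> simp [h]
      map_smul' := fun k f => by
        ext x; by_cases h : x.1 = e.left ∧ ∃ j, σ e j = x.2 <;> simp [h] }
  | .ghost e =>
    { toFun := fun f x => if x.1 = e.right then f (e.left, σ e x.2) else 0
      map_add' := fun f g => by ext x; by_cases h : x.1 = e.right <;> simp [h]
      map_smul' := fun k f => by ext x; by_cases h : x.1 = e.right <;> simp [h] }

open Classical in
theorem genAction_vertex_apply {I : Type*} (σ : Total V → I → I) (a : V) (f : V × I → K)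
    (x : V × I) : genAction K σ (.vertex a) f x = if x.1 = a then f x else 0 := rfl

open Classical in
theorem genAction_ghost_apply {I : Type*} (σ : Total V → I → I) (e : Total V) (f : V × I → K)
    (x : V × I) :
    genAction K σ (.ghost e) f x = if x.1 = e.right then f (e.left, σ e x.2) else 0 := rfl

theorem genAction_edge_apply {I : Type*} {σ : Total V → I → I}
    (hσ : ∀ (e f : Total V) i j, e.left = f.left → σ e i = σ f j → e = f ∧ i = j)
    (e : Total V) (f : V × I → K) (j : I) :
    genAction K σ (.edge e) f (e.left, σ e j) = f (e.right, j) := by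
  have h : ∃ i, σ e i = σ e j := ⟨j, rfl⟩
  have h₂ : h.choose = j := (hσ e e _ _ rfl h.choose_spec).2
  refine (dif_pos ⟨rfl, h⟩).trans ?_
  rw [h₂]

theorem genAction_edge_apply_of_not {I : Type*} {σ : Total V → I → I}
    (e : Total V) (f : V × I → K) (x : V × I) (h : ¬ (x.1 = e.left ∧ ∃ j, σ e j = x.2)) :
    genAction K σ (.edge e) f x = 0 := dif_neg h

variable (K) in
/-- The action of the free algebra given by a branching system. -/
def freeAction {I : Type*} (σ : Total V → I → I) :
    FreeAlg K V →ₙₐ[K] Module.End K (V × I → K) :=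
  MonoidAlgebra.liftMagma K (FreeSemigroup.lift (genAction K σ))

theorem freeAction_of {I : Type*} (σ : Total V → I → I) (g : Gen V) :
    freeAction K σ (FreeAlg.of K g) = genAction K σ g := by
  simp [freeAction, FreeAlg.of, MonoidAlgebra.liftMagma]

/-- Injectivity and disjointness of the images give (CK1); together with their covering property
they give (CK2). -/
theorem freeAction_eq_of_rel {I : Type*} {σ : Total V → I → I}
    (hσ : ∀ (e f : Total V) i j, e.left = f.left → σ e i = σ f j → e = f ∧ i = j)
    (hs : ∀ (e : Total V) i, ∃ (f : Total V) (j : _), f.left = e.left ∧ σ f j = i)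
    {x y : FreeAlg K V} (h : Rel K V x y) :
    freeAction K σ x = freeAction K σ y := by
  classical
  cases h with
  | v_same a =>
    ext f x
    by_cases h : x.1 = a <;> simp [freeAction_of, genAction_vertex_apply, h]
  | v_ne a b h =>
    ext f x
    simp only [map_mul, freeAction_of, Module.End.mul_apply, genAction_vertex_apply, map_zero,
      LinearMap.zero_apply, Pi.zero_apply]
    split_ifs with h₁ h₂
    · exact (h (h₁.symm.trans h₂)).elim
    · rfl
    · rfl
  | e1_left e =>
    ext f x
    simp only [map_mul, freeAction_of, Module.End.mul_apply, genAction_vertex_apply]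
    split_ifs with h
    · rfl
    · rw [genAction_edge_apply_of_not _ _ _ fun h' => h h'.1]
  | e1_right e =>
    ext f x
    simp only [map_mul, freeAction_of, Module.End.mul_apply]
    by_cases h : x.1 = e.left ∧ ∃ j, σ e j = x.2
    · obtain ⟨a, i⟩ := x
      obtain ⟨rfl, j, rfl⟩ := h
      rw [genAction_edge_apply hσ, genAction_edge_apply hσ, genAction_vertex_apply, if_pos rfl]
    · rw [genAction_edge_apply_of_not _ _ _ h, genAction_edge_apply_of_not _ _ _ h]
  | e2_left e =>
    ext f x
    simp only [map_mul, freeAction_of, Module.End.mul_apply, genAction_vertex_apply,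
      genAction_ghost_apply]
    split_ifs <;> rfl
  | e2_right e =>
    ext f x
    simp [freeAction_of, genAction_vertex_apply, genAction_ghost_apply]
  | ck1_same e =>
    ext f x
    simp only [map_mul, freeAction_of, Module.End.mul_apply, genAction_vertex_apply,
      genAction_ghost_apply]
    split_ifs with h
    · rw [genAction_edge_apply hσ, ← h]
    · rfl
  | ck1_ne e e' h =>
    ext f x
    simp only [map_mul, freeAction_of, Module.End.mul_apply, genAction_ghost_apply, map_zero,
      LinearMap.zero_apply, Pi.zero_apply]
    split_ifs with h₁
    · refine genAction_edge_apply_of_not _ _ _ ?_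
      rintro ⟨h₂, j, h₃⟩
      exact h (hσ e e' _ _ h₂ h₃.symm).1
    · rfl
  | ck2 a S hS hne =>
    ext f x
    simp only [map_sum, map_mul, freeAction_of, genAction_vertex_apply, LinearMap.sum_apply,
      Module.End.mul_apply, Finset.sum_apply]
    obtain ⟨b, i⟩ := x
    split_ifs with h
    · obtain ⟨e₀, he₀⟩ := hne
      -- Exactly one edge leaving `a` has `i` in its image; only its summand survives.
      obtain ⟨e, j, he, rfl⟩ := hs e₀ i
      have hea : e.left = a := he.trans ((hS e₀).1 he₀)
      have hb : b = e.left := h.trans hea.symm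
      subst hb
      rw [Finset.sum_eq_single_of_mem e ((hS e).2 hea), genAction_edge_apply hσ,
        genAction_ghost_apply, if_pos rfl]
      intro e' _ hne
      refine genAction_edge_apply_of_not _ _ _ ?_
      rintro ⟨h₂, j', h₃⟩
      exact hne (hσ e' e _ _ h₂.symm h₃).1
    · symm
      refine Finset.sum_eq_zero fun e he => genAction_edge_apply_of_not _ _ _ ?_
      rintro ⟨h₂, -⟩
      exact h (h₂.trans ((hS e).1 he))

theorem freeAction_eq_of_con {I : Type*} {σ : Total V → I → I}
    (hσ : ∀ (e f : Total V) i j, e.left = f.left → σ e i = σ f j → e = f ∧ i = j)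
    (hs : ∀ (e : Total V) i, ∃ (f : Total V) (j : _), f.left = e.left ∧ σ f j = i)
    {x y : FreeAlg K V} (h : con K V x y) :
    freeAction K σ x = freeAction K σ y := by
  change RingConGen.Rel _ _ _ at h
  induction h with
  | of x y h =>
    obtain ⟨k, a, b, hab, rfl, rfl⟩ := h
    rw [map_smul, map_smul, freeAction_eq_of_rel hσ hs hab]
  | refl x => rfl
  | symm _ ih => exact ih.symm
  | trans _ _ ih₁ ih₂ => exact ih₁.trans ih₂
  | add _ _ ih₁ ih₂ => rw [map_add, map_add, ih₁, ih₂]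
  | mul _ _ ih₁ ih₂ => rw [map_mul, map_mul, ih₁, ih₂]

variable (K) in
-- In the representation `a` acts as restriction to `{a} × I`, which does not kill the constant
-- function 1.
theorem vertex_ne_zero [Nontrivial K] (a : V) : vertex K a ≠ 0 := by
  intro h
  obtain ⟨σ, hσ, hs⟩ := exists_branching V
  have h₁ := freeAction_eq_of_con hσ hs ((RingCon.eq (con K V)).1 h)
  rw [freeAction_of, map_zero] at h₁
  have h₂ := congrFun (LinearMap.congr_fun h₁ 1) (a, Sum.inr 0)
  simp [genAction_vertex_apply] at h₂

end Representation

/-! ### Paths in the Leavitt path algebra -/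

section Paths

variable {K : Type w} [CommRing K] {V : Type u} [Quiver.{v} V]

variable (K) in
/-- The path `e₁ ⋯ eₙ`, as an element of the Leavitt path algebra. -/
def ofPath {a : V} : ∀ {b : V}, Path a b → LeavittPathAlgebra K V
  | _, .nil => vertex K a
  | _, .cons p e => ofPath p * edge K ⟨_, _, e⟩

variable (K) in
/-- The ghost path `eₙ* ⋯ e₁*`, as an element of the Leavitt path algebra. -/
def ghostPath {a : V} : ∀ {b : V}, Path a b → LeavittPathAlgebra K V
  | _, .nil => vertex K a
  | _, .cons p e => ghost K ⟨_, _, e⟩ * ghostPath p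

theorem ofPath_nil (a : V) : ofPath K (Path.nil : Path a a) = vertex K a := rfl

theorem ofPath_cons {a b c : V} (p : Path a b) (e : b ⟶ c) :
    ofPath K (p.cons e) = ofPath K p * edge K ⟨_, _, e⟩ := rfl

theorem ghostPath_cons {a b c : V} (p : Path a b) (e : b ⟶ c) :
    ghostPath K (p.cons e) = ghost K ⟨_, _, e⟩ * ghostPath K p := rfl

theorem source_mul_ofPath {a b : V} (p : Path a b) : vertex K a * ofPath K p = ofPath K p := by
  induction p with
  | nil => exact vertex_mul_self a
  | cons p e ih => rw [ofPath_cons, ← mul_assoc, ih]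

theorem ofPath_mul_target {a b : V} (p : Path a b) : ofPath K p * vertex K b = ofPath K p := by
  cases p with
  | nil => exact vertex_mul_self a
  | cons p e => rw [ofPath_cons, mul_assoc, edge_mul_right ⟨_, _, e⟩]

theorem ghostPath_mul_source {a b : V} (p : Path a b) :
    ghostPath K p * vertex K a = ghostPath K p := by
  induction p with
  | nil => exact vertex_mul_self a
  | cons p e ih => rw [ghostPath_cons, mul_assoc, ih]

theorem ofPath_comp {a b c : V} (p : Path a b) (q : Path b c) :
    ofPath K (p.comp q) = ofPath K p * ofPath K q := by
  induction q with
  | nil => exact (ofPath_mul_target p).symm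
  | cons q e ih => rw [Path.comp_cons, ofPath_cons, ofPath_cons, ih, mul_assoc]

theorem ofPath_toPath {a b : V} (e : a ⟶ b) : ofPath K e.toPath = edge K ⟨_, _, e⟩ :=
  left_mul_edge ⟨_, _, e⟩

theorem ghostPath_mul_ofPath_self {a b : V} (p : Path a b) :
    ghostPath K p * ofPath K p = vertex K b := by
  induction p with
  | nil => exact vertex_mul_self a
  | cons p e ih =>
    rw [ghostPath_cons, ofPath_cons, mul_assoc, ← mul_assoc (ghostPath K p), ih,
      left_mul_edge ⟨_, _, e⟩, ghost_mul_edge_self]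

theorem ghostPath_mul_ofPath_of_ne {a b c d : V} (h : a ≠ c) (p : Path a b) (q : Path c d) :
    ghostPath K p * ofPath K q = 0 := by
  rw [← ghostPath_mul_source, ← source_mul_ofPath q, mul_assoc, ← mul_assoc (vertex K a),
    vertex_mul_of_ne h, zero_mul, mul_zero]

/-- The product `p* q` is zero unless one of `p`, `q` is an initial segment of the other. -/
theorem ghostPath_mul_ofPath {a b d : V} (p : Path a b) (q : Path a d) :
    ghostPath K p * ofPath K q = 0 ∨
      (∃ r : Path b d, q = p.comp r ∧ ghostPath K p * ofPath K q = ofPath K r) ∨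
      ∃ r : Path d b, p = q.comp r ∧ ghostPath K p * ofPath K q = ghostPath K r := by
  induction p with
  | nil => exact .inr (.inl ⟨q, (Path.nil_comp q).symm, source_mul_ofPath q⟩)
  | @cons b c p e ih =>
    rw [ghostPath_cons, mul_assoc]
    rcases ih with h | ⟨r, hr, h⟩ | ⟨r, hr, h⟩
    · exact .inl (by rw [h, mul_zero])
    -- Here `q` extends `p` by `r`. If `r` is trivial, the new edge makes `p` the longer path;
    -- otherwise (CK1) compares `e` with the first edge of `r`.
    · rcases eq_nil_or_eq_comp r with ⟨rfl, rfl⟩ | ⟨c', f, r, rfl⟩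
      · refine .inr (.inr ⟨e.toPath, by rw [hr]; rfl, ?_⟩)
        rw [h]
        rfl
      · rw [h, ofPath_comp, ofPath_toPath, ← mul_assoc]
        by_cases hef : (⟨_, _, e⟩ : Quiver.Total V) = ⟨_, _, f⟩
        · simp only [Quiver.Total.mk.injEq, true_and] at hef
          obtain ⟨rfl, hef⟩ := hef
          obtain rfl := eq_of_heq hef
          rw [ghost_mul_edge_self, source_mul_ofPath]
          exact .inr (.inl ⟨r, by rw [hr, ← Path.comp_assoc]; rfl, rfl⟩)
        · exact .inl (by rw [ghost_mul_edge_of_ne hef, zero_mul])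
    · exact .inr (.inr ⟨r.cons e, by rw [hr]; rfl, by rw [h]; rfl⟩)

/-- If one of two parallel paths extended the other, the remainder would be closed, hence trivial.
-/
theorem _root_.LPA.IsAcyclic.ghostPath_mul_ofPath_of_ne (hV : IsAcyclic V) {a b : V}
    {p q : Path a b} (h : p ≠ q) : ghostPath K p * ofPath K q = 0 := by
  rcases ghostPath_mul_ofPath (K := K) p q with h' | ⟨r, hr, -⟩ | ⟨r, hr, -⟩
  · exact h'
  · rw [hV.eq_nil r] at hr
    exact (h hr.symm).elim
  · rw [hV.eq_nil r] at hr
    exact (h hr).elim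

end Paths

/-! ### Spanning by the elements `p q*` -/

section Span

variable {K : Type w} [CommRing K] {V : Type u} [Quiver.{v} V]

/-- The linear combinations of elements `p q*`, where `q` is a path of length at most `n` with
source `a`. -/
inductive IsCombination : ℕ → V → LeavittPathAlgebra K V → Prop
  | path (n : ℕ) {a b : V} (k : K) (p : Path a b) : IsCombination n b (k • ofPath K p)
  | add {n : ℕ} {a : V} {x y : LeavittPathAlgebra K V} :
      IsCombination n a x → IsCombination n a y → IsCombination n a (x + y)
  | ghost {n : ℕ} (e : Quiver.Total V) {x : LeavittPathAlgebra K V} :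
      IsCombination n e.right x → IsCombination (n + 1) e.left (x * ghost K e)

namespace IsCombination

theorem zero (n : ℕ) (a : V) : IsCombination n a (0 : LeavittPathAlgebra K V) := by
  simpa using path n (0 : K) (Path.nil : Path a a)

theorem of_vertex (n : ℕ) (a : V) : IsCombination n a (vertex K a) := by
  simpa [ofPath_nil] using path n (1 : K) (Path.nil : Path a a)

theorem smul {n : ℕ} {a : V} {x : LeavittPathAlgebra K V} (h : IsCombination n a x) (k : K) :
    IsCombination n a (k • x) := by
  induction h with
  | path n l p => rw [smul_smul]; exact path n _ p
  | add _ _ ih₁ ih₂ => rw [smul_add]; exact ih₁.add ih₂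
  | ghost e _ ih => rw [← smul_mul_assoc]; exact ghost e ih

theorem mono {n m : ℕ} (hnm : n ≤ m) {a : V} {x : LeavittPathAlgebra K V}
    (h : IsCombination n a x) : IsCombination m a x := by
  induction h generalizing m with
  | path n l p => exact path m l p
  | add _ _ ih₁ ih₂ => exact (ih₁ hnm).add (ih₂ hnm)
  | @ghost n e x _ ih =>
    obtain ⟨m, rfl⟩ : ∃ k, m = k + 1 := ⟨m - 1, by omega⟩
    exact ghost e (ih (by omega))

theorem mul_vertex_self {n : ℕ} {a : V} {x : LeavittPathAlgebra K V} (h : IsCombination n a x) :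
    x * LeavittPathAlgebra.vertex K a = x := by
  induction h with
  | path n l p => rw [smul_mul_assoc, ofPath_mul_target]
  | add _ _ ih₁ ih₂ => rw [add_mul, ih₁, ih₂]
  | ghost e _ _ => rw [mul_assoc, ghost_mul_left]

/-- An edge either prolongs a real path or meets a final ghost edge, where (CK1) applies. The drop
in the bound drives the induction in `exists_mul_ofPath`. -/
theorem mul_edge_aux {n : ℕ} {a : V} {x : LeavittPathAlgebra K V} (h : IsCombination n a x) :
    ∀ e : Quiver.Total V, e.left = a → IsCombination (n - 1) e.right (x * edge K e) := by
  classical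
  induction h with
  | path n l p =>
    rintro ⟨b, c, e⟩ rfl
    rw [smul_mul_assoc, ← ofPath_cons]
    exact path _ _ _
  | add _ _ ih₁ ih₂ =>
    intro e he
    rw [add_mul]
    exact (ih₁ e he).add (ih₂ e he)
  | @ghost n f x hx _ =>
    intro e he
    rw [mul_assoc]
    by_cases hfe : f = e
    · subst hfe
      rw [ghost_mul_edge_self, hx.mul_vertex_self]
      exact hx
    · rw [ghost_mul_edge_of_ne hfe, mul_zero]
      exact zero _ _

theorem mul_edge {n : ℕ} {e : Quiver.Total V} {x : LeavittPathAlgebra K V}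
    (h : IsCombination n e.left x) : IsCombination (n - 1) e.right (x * edge K e) :=
  h.mul_edge_aux e rfl

/-- Products with a generator. -/
theorem mul_gen {n : ℕ} {a : V} {x : LeavittPathAlgebra K V} (h : IsCombination n a x)
    (g : Gen V) : ∃ m b, IsCombination m b (x * mk K V (.of K g)) := by
  classical
  cases g with
  | vertex b =>
    refine ⟨n, a, ?_⟩
    change IsCombination n a (x * LeavittPathAlgebra.vertex K b)
    by_cases hab : a = b
    · subst hab
      rwa [h.mul_vertex_self]
    · rw [← h.mul_vertex_self, mul_assoc, vertex_mul_of_ne hab, mul_zero]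
      exact zero _ _
  | edge e =>
    refine ⟨n - 1, e.right, ?_⟩
    change IsCombination (n - 1) e.right (x * LeavittPathAlgebra.edge K e)
    by_cases hab : a = e.left
    · subst hab
      exact h.mul_edge
    · rw [← h.mul_vertex_self, mul_assoc, vertex_mul_edge_of_ne hab, mul_zero]
      exact zero _ _
  | ghost e =>
    refine ⟨n + 1, e.left, ?_⟩
    change IsCombination (n + 1) e.left (x * LeavittPathAlgebra.ghost K e)
    by_cases hab : a = e.right
    · subst hab
      exact ghost e h
    · rw [← h.mul_vertex_self, mul_assoc, vertex_mul_ghost_of_ne hab, mul_zero]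
      exact zero _ _

end IsCombination

variable (K) in
/-- A word in the generators, as an element of the Leavitt path algebra. -/
def ofWord (s : FreeSemigroup (Gen V)) : LeavittPathAlgebra K V :=
  mk K V (MonoidAlgebra.ofMagma K _ s)

theorem ofWord_mul (s t : FreeSemigroup (Gen V)) :
    ofWord K (s * t) = ofWord K s * ofWord K t := by
  rw [ofWord, map_mul]
  rfl

theorem induction_word {P : LeavittPathAlgebra K V → Prop}
    (zero : P 0) (word : ∀ s, P (ofWord K s)) (add : ∀ x y, P x → P y → P (x + y))
    (smul : ∀ (k : K) x, P x → P (k • x)) (x : LeavittPathAlgebra K V) : P x := by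
  obtain ⟨x, rfl⟩ := mk_surjective K V x
  induction x using MonoidAlgebra.induction_linear with
  | zero => exact zero
  | add x y hx hy => exact add _ _ hx hy
  | single s k =>
    have : (MonoidAlgebra.single s k : FreeAlg K V) = k • MonoidAlgebra.ofMagma K _ s := by simp
    rw [this, mk_smul]
    exact smul k _ (word s)

theorem IsCombination.mul_word {n : ℕ} {a : V} {x : LeavittPathAlgebra K V}
    (h : IsCombination n a x) (s : FreeSemigroup (Gen V)) :
    ∃ m b, IsCombination m b (x * ofWord K s) := by
  induction s using FreeSemigroup.recOnMul generalizing n a x with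
  | ih1 g => exact h.mul_gen g
  | ih2 g s _ ih =>
    obtain ⟨m, b, h'⟩ := h.mul_gen g
    rw [ofWord_mul, ← mul_assoc]
    exact ih h'

theorem exists_vertex_mul_gen (g : Gen V) :
    ∃ a : V, vertex K a * mk K V (.of K g) = mk K V (.of K g) := by
  cases g with
  | vertex a => exact ⟨a, vertex_mul_self a⟩
  | edge e => exact ⟨e.left, left_mul_edge e⟩
  | ghost e => exact ⟨e.right, right_mul_ghost e⟩

theorem exists_isCombination_ofWord (s : FreeSemigroup (Gen V)) :
    ∃ m a, IsCombination m a (ofWord K s) := by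
  obtain ⟨a, ha⟩ : ∃ a, vertex K a * ofWord K s = ofWord K s := by
    induction s using FreeSemigroup.recOnMul with
    | ih1 g => exact exists_vertex_mul_gen g
    | ih2 g s h _ =>
      obtain ⟨a, ha⟩ := h
      exact ⟨a, by rw [ofWord_mul, ← mul_assoc, ha]⟩
  rw [← ha]
  exact (IsCombination.of_vertex 0 a).mul_word s

/-- A general element mixes terms with different right-hand vertices; multiplying by `a` selects
one. -/
theorem exists_isCombination_mul_vertex (x : LeavittPathAlgebra K V) (a : V) :
    ∃ n, IsCombination n a (x * vertex K a) := by
  classical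
  induction x using induction_word with
  | zero => exact ⟨0, by rw [zero_mul]; exact .zero _ _⟩
  | word s =>
    obtain ⟨n, b, h⟩ := exists_isCombination_ofWord (K := K) s
    by_cases hb : b = a
    · subst hb
      exact ⟨n, by rwa [h.mul_vertex_self]⟩
    · refine ⟨0, ?_⟩
      rw [← h.mul_vertex_self, mul_assoc, vertex_mul_of_ne hb, mul_zero]
      exact .zero _ _
  | add x y hx hy =>
    obtain ⟨n, hx⟩ := hx
    obtain ⟨m, hy⟩ := hy
    refine ⟨max n m, ?_⟩
    rw [add_mul]
    exact (hx.mono (le_max_left n m)).add (hy.mono (le_max_right n m))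
  | smul k x hx =>
    obtain ⟨n, hx⟩ := hx
    refine ⟨n, ?_⟩
    rw [smul_mul_assoc]
    exact hx.smul k

/-- Sums of vertices are right local units. -/
theorem exists_mul_sum_vertex (x : LeavittPathAlgebra K V) :
    ∃ F : Finset V, ∀ F', F ⊆ F' → x * ∑ a ∈ F', vertex K a = x := by
  classical
  induction x using induction_word with
  | zero => exact ⟨∅, fun F' _ => zero_mul _⟩
  | word s =>
    obtain ⟨n, b, h⟩ := exists_isCombination_ofWord (K := K) s
    refine ⟨{b}, fun F' hF' => ?_⟩
    rw [Finset.mul_sum, Finset.sum_eq_single_of_mem b (by simpa using hF'), h.mul_vertex_self]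
    intro c _ hc
    rw [← h.mul_vertex_self, mul_assoc, vertex_mul_of_ne hc.symm, mul_zero]
  | add x y hx hy =>
    obtain ⟨F, hF⟩ := hx
    obtain ⟨G, hG⟩ := hy
    refine ⟨F ∪ G, fun F' hF' => ?_⟩
    rw [add_mul, hF F' (Finset.union_subset_left hF'), hG F' (Finset.union_subset_right hF')]
  | smul k x hx =>
    obtain ⟨F, hF⟩ := hx
    exact ⟨F, fun F' hF' => by rw [smul_mul_assoc, hF F' hF']⟩

theorem exists_mul_vertex_ne_zero {x : LeavittPathAlgebra K V} (hx : x ≠ 0) :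
    ∃ a : V, x * vertex K a ≠ 0 := by
  by_contra! h
  obtain ⟨F, hF⟩ := exists_mul_sum_vertex x
  apply hx
  rw [← hF F subset_rfl, Finset.mul_sum]
  exact Finset.sum_eq_zero fun a _ => h a

end Span

/-! ### The reduction theorem for acyclic graphs -/

section Reduction

variable {K : Type w} [Field K] {V : Type u} [Quiver.{v} V]

theorem IsCombination.exists_finsupp {x : LeavittPathAlgebra K V} {a : V}
    (h : IsCombination 0 a x) :
    ∃ f : (Σ b, Path b a) →₀ K, x = f.sum fun p k => k • ofPath K p.2 := by
  classical
  generalize hn : 0 = n at h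
  induction h with
  | @path n b a k p =>
    exact ⟨Finsupp.single ⟨b, p⟩ k, by simp⟩
  | add _ _ ih₁ ih₂ =>
    obtain ⟨f, rfl⟩ := ih₁ hn
    obtain ⟨g, rfl⟩ := ih₂ hn
    refine ⟨f + g, (Finsupp.sum_add_index' ?_ ?_).symm⟩
    · exact fun p => zero_smul _ _
    · exact fun p k l => add_smul _ _ _
  | ghost e _ _ => omega

/-- For `p` in the support, `p*` kills every other path: by orthogonality of vertices if the sources
differ, by acyclicity if they agree. -/
theorem IsCombination.exists_ghostPath_mul (hV : IsAcyclic V) {x : LeavittPathAlgebra K V} {a : V}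
    (h : IsCombination 0 a x) (hx : x ≠ 0) :
    ∃ (b : V) (p : Path b a) (k : K), k ≠ 0 ∧ ghostPath K p * x = k • vertex K a := by
  obtain ⟨f, rfl⟩ := h.exists_finsupp
  have hf : f ≠ 0 := by
    rintro rfl
    exact hx Finsupp.sum_zero_index
  obtain ⟨⟨b, p⟩, hp⟩ := Finsupp.ne_iff.1 hf
  refine ⟨b, p, f ⟨b, p⟩, hp, ?_⟩
  rw [Finsupp.sum, Finset.mul_sum,
    Finset.sum_eq_single_of_mem ⟨b, p⟩ (Finsupp.mem_support_iff.2 hp),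
    mul_smul_comm, ghostPath_mul_ofPath_self]
  rintro ⟨c, q⟩ _ hq
  rw [mul_smul_comm]
  by_cases hbc : b = c
  · subst hbc
    rw [hV.ghostPath_mul_ofPath_of_ne (fun h => hq (by rw [h])), smul_zero]
  · rw [ghostPath_mul_ofPath_of_ne hbc, smul_zero]

theorem edge_ne_zero (e : Quiver.Total V) : edge K e ≠ 0 := by
  intro h
  apply vertex_ne_zero K e.right
  rw [← ghost_mul_edge_self, h, mul_zero]

/-- Up to a right multiple of finitely many elements `ee*`, a combination of elements `p q*` is
a combination of paths. -/
theorem IsCombination.exists_sub_mul_sum {n : ℕ} {a : V} {x : LeavittPathAlgebra K V}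
    (h : IsCombination n a x) :
    ∃ (y : LeavittPathAlgebra K V) (F : Finset (Quiver.Total V)), IsCombination 0 a y ∧
      (∀ e ∈ F, e.left = a) ∧
      ∀ F', F ⊆ F' → (x - y) * ∑ e ∈ F', edge K e * LeavittPathAlgebra.ghost K e = x - y := by
  classical
  induction h with
  | path n k p => exact ⟨_, ∅, path 0 k p, by simp, fun F' _ => by rw [sub_self, zero_mul]⟩
  | @add n a x₁ x₂ _ _ ih₁ ih₂ =>
    obtain ⟨y, F, hy, hF, hxy⟩ := ih₁
    obtain ⟨z, G, hz, hG, hxz⟩ := ih₂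
    -- Stability under enlarging the set of edges allows the union.
    refine ⟨y + z, F ∪ G, hy.add hz, fun e he => ?_, fun F' hF' => ?_⟩
    · exact (Finset.mem_union.1 he).elim (hF e) (hG e)
    · rw [add_sub_add_comm, add_mul, hxy F' (Finset.union_subset_left hF'),
        hxz F' (Finset.union_subset_right hF')]
  | @ghost n e x _ _ =>
    refine ⟨0, {e}, .zero _ _, by simp, fun F' hF' => ?_⟩
    rw [sub_zero, Finset.mul_sum, Finset.sum_eq_single_of_mem e (by simpa using hF')]
    · rw [← mul_assoc, mul_assoc x, ghost_mul_edge_self, mul_assoc, right_mul_ghost]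
    · intro f _ hf
      rw [← mul_assoc, mul_assoc x, ghost_mul_edge_of_ne hf.symm, mul_zero, zero_mul]

/-- A combination annihilated by all edges is a combination of paths. -/
theorem IsCombination.of_mul_edge_eq_zero (hV : IsAcyclic V) {n : ℕ} {a : V}
    {x : LeavittPathAlgebra K V} (h : IsCombination n a x)
    (hx : ∀ e : Quiver.Total V, e.left = a → x * edge K e = 0) : IsCombination 0 a x := by
  classical
  obtain ⟨y, F, hy, hF, hxy⟩ := h.exists_sub_mul_sum
  have hxF : x * ∑ e ∈ F, edge K e * LeavittPathAlgebra.ghost K e = 0 := by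
    rw [Finset.mul_sum]
    exact Finset.sum_eq_zero fun e he => by rw [← mul_assoc, hx e (hF e he), zero_mul]
  have hxy := hxy F subset_rfl
  by_cases hall : ∀ e : Quiver.Total V, e.left = a → e ∈ F
  -- If `F` holds all edges leaving `a`, then either `a` is a sink and `x = y`, or (CK2) turns the
  -- sum into `a` and `x = 0`.
  · rcases F.eq_empty_or_nonempty with rfl | hne
    · rw [Finset.sum_empty, mul_zero] at hxy
      rwa [sub_eq_zero.1 hxy.symm]
    · rw [← vertex_eq_sum a F (fun e => ⟨hF e, hall e⟩) hne, h.mul_vertex_self] at hxF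
      rw [hxF]
      exact .zero _ _
  · push Not at hall
    -- An edge `f` outside `F` is killed by `x - y` and by `x`, hence by `y`. Reducing `y ≠ 0` to a
    -- multiple of `a` would give `f = 0`.
    obtain ⟨f, hfa, hf⟩ := hall
    have hsum : (∑ e ∈ F, edge K e * LeavittPathAlgebra.ghost K e) * edge K f = 0 := by
      rw [Finset.sum_mul]
      refine Finset.sum_eq_zero fun e he => ?_
      rw [mul_assoc, ghost_mul_edge_of_ne (by rintro rfl; exact hf he), mul_zero]
    have hyf : y * edge K f = 0 := by
      have : (x - y) * edge K f = 0 := by rw [← hxy, mul_assoc, hsum, mul_zero]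
      rw [sub_mul, hx f hfa, zero_sub, neg_eq_zero] at this
      exact this
    have hy0 : y = 0 := by
      by_contra hne
      obtain ⟨b, p, k, hk, hp⟩ := hy.exists_ghostPath_mul hV hne
      have : k • edge K f = 0 := by
        rw [← left_mul_edge, hfa, ← smul_mul_assoc, ← hp, mul_assoc, hyf, mul_zero]
      exact (smul_ne_zero hk (edge_ne_zero f)) this
    rw [hy0, sub_zero] at hxy
    rw [← hxy, hxF]
    exact .zero _ _

/-- An edge not killed by `x` lowers the ghost bound; if there is none, `x` is already a combination
of paths. -/
theorem IsCombination.exists_mul_ofPath (hV : IsAcyclic V) {n : ℕ} {a : V}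
    {x : LeavittPathAlgebra K V} (h : IsCombination n a x) (hx : x ≠ 0) :
    ∃ (b : V) (q : Path a b), IsCombination 0 b (x * ofPath K q) ∧ x * ofPath K q ≠ 0 := by
  induction n generalizing a x with
  | zero =>
    exact ⟨a, .nil, by rwa [ofPath_nil, h.mul_vertex_self], by rwa [ofPath_nil, h.mul_vertex_self]⟩
  | succ n ih =>
    by_cases H : ∀ e : Quiver.Total V, e.left = a → x * edge K e = 0
    · exact ⟨a, .nil, by rw [ofPath_nil, h.mul_vertex_self]; exact h.of_mul_edge_eq_zero hV H,
        by rwa [ofPath_nil, h.mul_vertex_self]⟩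
    · push Not at H
      obtain ⟨⟨a, c, e⟩, rfl, he⟩ := H
      obtain ⟨b, q, h₁, h₂⟩ := ih h.mul_edge he
      have key : x * ofPath K (e.toPath.comp q) = x * edge K ⟨a, c, e⟩ * ofPath K q := by
        rw [ofPath_comp, ofPath_toPath, mul_assoc]
      exact ⟨b, e.toPath.comp q, by rwa [key], by rwa [key]⟩

/-- The reduction theorem for acyclic graphs. -/
theorem exists_ghostPath_mul_mul_ofPath (hV : IsAcyclic V) {x : LeavittPathAlgebra K V}
    (hx : x ≠ 0) :
    ∃ (a b c : V) (p : Path a c) (q : Path b c) (k : K), k ≠ 0 ∧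
      ghostPath K p * x * ofPath K q = k • vertex K c := by
  obtain ⟨b, hb⟩ := exists_mul_vertex_ne_zero hx
  obtain ⟨n, hn⟩ := exists_isCombination_mul_vertex x b
  obtain ⟨c, q, h₁, h₂⟩ := hn.exists_mul_ofPath hV hb
  rw [mul_assoc, source_mul_ofPath] at h₁ h₂
  obtain ⟨a, p, k, hk, hp⟩ := h₁.exists_ghostPath_mul hV h₂
  exact ⟨a, b, c, p, q, k, hk, by rw [mul_assoc, hp]⟩

end Reduction

/-! ### Primeness -/

section Prime

/-- The elementwise form of primeness. -/
theorem _root_.LPA.IsPrimeRing.eq_zero_or_eq_zero {A : Type*} [NonUnitalRing A]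
    (hA : IsPrimeRing A) {x y : A} (hxy : x * y = 0) (h : ∀ l, x * l * y = 0) :
    x = 0 ∨ y = 0 := by
  -- `J` annihilates `x` and `xA` from the right, both being needed without a unit; `I` is the left
  -- annihilator of `J`.
  let J : TwoSidedIdeal A := .mk' {b | x * b = 0 ∧ ∀ l, x * l * b = 0}
    ⟨mul_zero _, fun l => mul_zero _⟩
    (fun {b c} hb hc => ⟨by rw [mul_add, hb.1, hc.1, add_zero],
      fun l => by rw [mul_add, hb.2, hc.2, add_zero]⟩)
    (fun {b} hb => ⟨by rw [mul_neg, hb.1, neg_zero], fun l => by rw [mul_neg, hb.2, neg_zero]⟩)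
    (fun {m b} hb => ⟨by rw [← mul_assoc, hb.2],
      fun l => by rw [← mul_assoc, mul_assoc x, hb.2]⟩)
    (fun {b m} hb => ⟨by rw [← mul_assoc, hb.1, zero_mul],
      fun l => by rw [← mul_assoc, hb.2, zero_mul]⟩)
  have mem_J : ∀ b, b ∈ J ↔ x * b = 0 ∧ ∀ l, x * l * b = 0 := fun b =>
    TwoSidedIdeal.mem_mk' _ _ _ _ _ _ _
  let I : TwoSidedIdeal A := .mk' {a | ∀ b ∈ J, a * b = 0}
    (fun b _ => zero_mul b)
    (fun {a c} ha hc b hb => by rw [add_mul, ha b hb, hc b hb, add_zero])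
    (fun {a} ha b hb => by rw [neg_mul, ha b hb, neg_zero])
    (fun {m a} ha b hb => by rw [mul_assoc, ha b hb, mul_zero])
    (fun {a m} ha b hb => by rw [mul_assoc, ha _ (J.mul_mem_left m b hb)])
  have mem_I : ∀ a, a ∈ I ↔ ∀ b ∈ J, a * b = 0 := fun b =>
    TwoSidedIdeal.mem_mk' _ _ _ _ _ _ _
  rcases hA.2 I J fun a ha b hb => (mem_I a).1 ha b hb with hI | hJ
  · have : x ∈ I := (mem_I x).2 fun b hb => ((mem_J b).1 hb).1
    rw [hI] at this
    exact .inl ((TwoSidedIdeal.mem_bot A).1 this)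
  · have : y ∈ J := (mem_J y).2 ⟨hxy, h⟩
    rw [hJ] at this
    exact .inr ((TwoSidedIdeal.mem_bot A).1 this)

variable {K : Type w} [Field K] {V : Type u} [Quiver.{v} V]

/-- Reduce `x` and `y` to vertices and carry both to a common vertex `d`: a suitable `x l y`,
multiplied on both sides, becomes a nonzero multiple of `d`. -/
theorem eq_zero_or_eq_zero_of_conditionMT3 (hV : IsAcyclic V) (hMT3 : ConditionMT3 V)
    {x y : LeavittPathAlgebra K V} (h : ∀ l, x * l * y = 0) : x = 0 ∨ y = 0 := by
  by_contra! hne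
  obtain ⟨a, b, c, p, q, k, hk, hx⟩ := exists_ghostPath_mul_mul_ofPath hV hne.1
  obtain ⟨a', b', c', p', q', k', hk', hy⟩ := exists_ghostPath_mul_mul_ofPath hV hne.2
  obtain ⟨d, ⟨r⟩, ⟨s⟩⟩ := hMT3 c c'
  have key : ghostPath K r * (ghostPath K p * x * ofPath K q) * ofPath K r *
      (ghostPath K s * (ghostPath K p' * y * ofPath K q') * ofPath K s) = 0 := by
    have := h (ofPath K q * ofPath K r * ghostPath K s * ghostPath K p')
    have h' := congrArg (fun m => ghostPath K r * ghostPath K p * m * (ofPath K q' * ofPath K s))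
      this
    simpa only [mul_assoc, zero_mul, mul_zero] using h'
  rw [hx, hy] at key
  simp only [mul_smul_comm, smul_mul_assoc, ghostPath_mul_ofPath_self, mul_assoc,
    source_mul_ofPath, vertex_mul_self] at key
  exact smul_ne_zero hk' (smul_ne_zero hk (vertex_ne_zero K d)) key

end Prime

/-! ### Central elements of corners -/

section Center

variable {K : Type w} [Field K] {V : Type u} [Quiver.{v} V]

theorem exists_eq_smul_vertex (hV : IsAcyclic V)
    (hprime : ∀ x y : LeavittPathAlgebra K V, x * y = 0 → (∀ l, x * l * y = 0) → x = 0 ∨ y = 0)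
    {u : V} {z : LeavittPathAlgebra K V} (hl : vertex K u * z = z) (hr : z * vertex K u = z)
    (hz : ∀ x, vertex K u * x = x → x * vertex K u = x → z * x = x * z) :
    ∃ k : K, z = k • vertex K u := by
  classical
  by_cases hz0 : z = 0
  · exact ⟨0, by rw [hz0, zero_smul]⟩
  obtain ⟨a, b, c, p, q, k, hk, hpq⟩ := exists_ghostPath_mul_mul_ofPath hV hz0
  have hne : ghostPath K p * z * ofPath K q ≠ 0 := hpq ▸ smul_ne_zero hk (vertex_ne_zero K c)
  obtain rfl : a = u := by
    by_contra h
    apply hne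
    rw [← hl, ← ghostPath_mul_source, mul_assoc (ghostPath K p), ← mul_assoc (vertex K a),
      vertex_mul_of_ne h, zero_mul, mul_zero, zero_mul]
  obtain rfl : a = b := by
    by_contra h
    apply hne
    rw [← hr, ← source_mul_ofPath q, mul_assoc, mul_assoc z, ← mul_assoc (vertex K a),
      vertex_mul_of_ne h, zero_mul, mul_zero, mul_zero]
  have hcomm : ∀ r : Path a c, z * (ofPath K r * ghostPath K p) = ofPath K r * ghostPath K p * z :=
    fun r => hz _ (by rw [← mul_assoc, source_mul_ofPath])
      (by rw [mul_assoc, ghostPath_mul_source])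
  -- Indeed `p* z q = p* z (q p*) p = (p* q) p* z p`.
  obtain rfl : p = q := by
    by_contra h
    apply hne
    rw [← ofPath_mul_target q, ← ghostPath_mul_ofPath_self p, mul_assoc,
      ← mul_assoc (ofPath K q), ← mul_assoc z, hcomm, ← mul_assoc, ← mul_assoc, ← mul_assoc,
      hV.ghostPath_mul_ofPath_of_ne h, zero_mul, zero_mul, zero_mul]
  have hzp : z * ofPath K p = k • ofPath K p := by
    rw [← ofPath_mul_target p, ← mul_smul_comm, ← hpq, ← ghostPath_mul_ofPath_self p,
      ← mul_assoc (ofPath K p), ← mul_assoc z, hcomm]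
    simp only [mul_assoc]
  refine ⟨k, sub_eq_zero.1 ?_⟩
  have hw : (z - k • vertex K a) * ofPath K p = 0 := by
    rw [sub_mul, hzp, smul_mul_assoc, source_mul_ofPath, sub_self]
  have hwr : (z - k • vertex K a) * vertex K a = z - k • vertex K a := by
    rw [sub_mul, hr, smul_mul_assoc, vertex_mul_self]
  refine (hprime _ (ofPath K p) hw fun l => ?_).resolve_right fun h => ?_
  -- Compressing `l` to the corner does not change the product, and there `z - k a` commutes past it
  -- to reach `p`.
  · have hx₁ : vertex K a * (vertex K a * l * vertex K a) = vertex K a * l * vertex K a := by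
      rw [← mul_assoc, ← mul_assoc, vertex_mul_self]
    have hx₂ : vertex K a * l * vertex K a * vertex K a = vertex K a * l * vertex K a := by
      rw [mul_assoc, vertex_mul_self]
    have hc : (z - k • vertex K a) * (vertex K a * l * vertex K a) =
        vertex K a * l * vertex K a * (z - k • vertex K a) := by
      rw [sub_mul, mul_sub, hz _ hx₁ hx₂, smul_mul_assoc, mul_smul_comm, hx₁, hx₂]
    calc (z - k • vertex K a) * l * ofPath K p
        = (z - k • vertex K a) * (vertex K a * l * vertex K a) * ofPath K p := by
          rw [← mul_assoc, ← mul_assoc, hwr, mul_assoc _ (vertex K a), source_mul_ofPath]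
      _ = 0 := by rw [hc, mul_assoc, hw, mul_zero]
  · apply vertex_ne_zero K c
    rw [← ghostPath_mul_ofPath_self p, h, mul_zero]

end Center

/-! ### The centroid -/

section Centroid

variable {K : Type w} [Field K] {V : Type u} [Quiver.{v} V]

theorem exists_eq_smul_of_mem_centroid (hV : IsAcyclic V)
    (hprime : ∀ x y : LeavittPathAlgebra K V, x * y = 0 → (∀ l, x * l * y = 0) → x = 0 ∨ y = 0)
    [Nonempty V] {τ : Module.End K (LeavittPathAlgebra K V)}
    (hτ : τ ∈ centroid K (LeavittPathAlgebra K V)) : ∃ k : K, ∀ x, τ x = k • x := by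
  obtain ⟨u⟩ := ‹Nonempty V›
  have hτ' : ∀ x y, τ (x * y) = τ x * y ∧ τ (x * y) = x * τ y := hτ
  obtain ⟨k, hk⟩ : ∃ k : K, τ (vertex K u) = k • vertex K u := by
    refine exists_eq_smul_vertex hV hprime ?_ ?_ fun x hl hr => ?_
    · rw [← (hτ' _ _).2, vertex_mul_self]
    · rw [← (hτ' _ _).1, vertex_mul_self]
    · rw [← (hτ' _ _).1, ← (hτ' _ _).2, hl, hr]
  refine ⟨k, fun x => sub_eq_zero.1 ?_⟩
  have key : ∀ y, (τ y - k • y) * vertex K u = 0 := fun y => by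
    rw [sub_mul, ← (hτ' _ _).1, (hτ' _ _).2, hk, smul_mul_assoc, mul_smul_comm, sub_self]
  refine (hprime _ _ (key x) fun l => ?_).resolve_right (vertex_ne_zero K u)
  rw [sub_mul, ← (hτ' _ _).1, smul_mul_assoc]
  exact key (x * l)

end Centroid

end LeavittPathAlgebra

end LPA

end

theorem mainTheorem7 (K : Type*) [Field K] (V : Type*) [Quiver V] :
    -- the centroid of a prime Leavitt path algebra of an acyclic graph
    (LPA.IsPrimeRing (LPA.LeavittPathAlgebra K V) → LPA.IsAcyclic V →
      Nonempty (LPA.centroid K (LPA.LeavittPathAlgebra K V) ≃ₐ[K] K)) ∧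
    -- the center of each vertex corner, for acyclic graphs with (MT3)
    (LPA.IsAcyclic V → LPA.ConditionMT3 V →
      ∀ (a : V) (z : NonUnitalRing.corner (LPA.LeavittPathAlgebra.vertex K a)),
        z ∈ NonUnitalSubring.center (NonUnitalRing.corner (LPA.LeavittPathAlgebra.vertex K a)) ↔
          ∃ k : K, (z : LPA.LeavittPathAlgebra K V) =
            k • LPA.LeavittPathAlgebra.vertex K a) := by
  open LPA LPA.LeavittPathAlgebra in
  refine ⟨fun hprime hV => ?_, fun hV hMT3 a z => ?_⟩
  · have := hprime.1
    obtain ⟨x, hx⟩ := exists_ne (0 : LeavittPathAlgebra K V)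
    -- Primeness includes nontriviality, which provides a vertex.
    have : Nonempty V := (exists_mul_vertex_ne_zero hx).nonempty
    refine ⟨(AlgEquiv.ofBijective (Algebra.ofId K (centroid K (LeavittPathAlgebra K V)))
      ⟨fun k l hkl => ?_, fun τ => ?_⟩).symm⟩
    · exact smul_left_injective K hx (LinearMap.congr_fun (congrArg Subtype.val hkl) x)
    · obtain ⟨k, hk⟩ := exists_eq_smul_of_mem_centroid hV
        (fun _ _ => hprime.eq_zero_or_eq_zero) τ.2
      exact ⟨k, Subtype.ext (LinearMap.ext fun y => (hk y).symm)⟩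
  · have idem : IsIdempotentElem (vertex K a) := vertex_mul_self a
    have hcorner : ∀ {x : LeavittPathAlgebra K V}, x ∈ NonUnitalRing.corner (vertex K a) ↔
        vertex K a * x = x ∧ x * vertex K a = x := Subsemigroup.mem_corner_iff idem
    have hz := hcorner.1 z.2
    constructor
    · intro hc
      refine exists_eq_smul_vertex hV
        (fun _ _ _ => eq_zero_or_eq_zero_of_conditionMT3 hV hMT3) hz.1 hz.2 fun x hl hr => ?_
      exact congrArg Subtype.val ((hc.comm ⟨x, hcorner.2 ⟨hl, hr⟩⟩).eq)
    · rintro ⟨k, hk⟩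
      refine Subsemigroup.mem_center_iff.2 fun x => Subtype.ext ?_
      have hx := hcorner.1 x.2
      change (x : LeavittPathAlgebra K V) * z = z * x
      rw [hk, mul_smul_comm, smul_mul_assoc, hx.1, hx.2]
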